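/- Let $(W,w_0)$ be a well-pointed space (the inclusion of $w_0$ is a cofibration). Maps and homotopies are base point preserving, $[X,Y]$ denotes pointed homotopy classes, $\Sigma$ is the reduced suspension, and $[\Sigma A,X]$ has its usual group structure, $[f][g]=[(f,g)\circ\sigma_A]$ with $\sigma_A:\Sigma A\to\Sigma A\vee\Sigma A$ the suspension co-multiplication. For $n\ge 1$ put $\hat{\mathfrak F}_n=\Sigma(W^{n-1}\sqcup *)$, so that $\tau_{W^{n-1}}(X)=[\hat{\mathfrak F}_n,X]$, and $P_n=W^n/W^{n-1}$, where $W^{n-1}\subset W^n$ is the set of points with last coordinate $w_0$. Let $n>1$, write $P=P_{n-1}$, $Q=\Sigma P\vee\hat{\mathfrak F}_{n-1}$, and let $q:\hat{\mathfrak F}_n\to\Sigma P$ and $p:\hat{\mathfrak F}_n\to\hat{\mathfrak F}_{n-1}$ be the suspensions of the pinch map $W^{n-1}\sqcup *\to P$ and of the projection $W^{n-1}\sqcup *\to W^{n-2}\sqcup *$ that forgets the last coordinate. (1) The map $e:\hat{\mathfrak F}_n\to Q$ that represents $(a,b)\mapsto p^*(b)\,q^*(a)$, $[\Sigma P,X]\times[\hat{\mathfrak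 F}_{n-1},X]\to\tau_{W^{n-1}}(X)$ (explicitly, $e$ is $\sigma_{W^{n-1}\sqcup *}$ followed by $p$ on the first summand and $q$ on the second), is a pointed homotopy equivalence $\hat{\mathfrak F}_n\simeq\Sigma P\vee\hat{\mathfrak F}_{n-1}$. (2) There is, up to pointed homotopy, exactly one map $\alpha:\Sigma P\to\hat{\mathfrak F}_{n-1}\vee\Sigma P$ with $q^*[\alpha]=p^*[\iota_1]^{-1}\,q^*[\iota_2]\,p^*[\iota_1]$ in $\tau_{W^{n-1}}(\hat{\mathfrak F}_{n-1}\vee\Sigma P)$, where $\iota_1,\iota_2$ are the inclusions of $\hat{\mathfrak F}_{n-1}$ and $\Sigma P$ (the co-action that represents the conjugation action of $[\hat{\mathfrak F}_{n-1},X]$ on $[\Sigma P,X]$). (3) Let $\nu_n:Q\to Q\vee Q$ be the map whose restriction to $\hat{\mathfrak F}_{n-1}$ is $$\hat{\mathfrak F}_{n-1}\xrightarrow{\nu_{n-1}}\hat{\mathfrak F}_{n-1}\vee\hat{\mathfrak F}_{n-1}\hookrightarrow Q\vee Q,$$ with $\nu_{n-1}$ the suspension co-multiplication, and whose restriction to $\Sigma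 P$ is $$\Sigma P\xrightarrow{\nu}\Sigma P\vee\Sigma P\xrightarrow{\alpha\vee 1}\hat{\mathfrak F}_{n-1}\vee\Sigma P\vee\Sigma P\hookrightarrow Q\vee Q,$$ with $\nu$ the suspension co-multiplication, where the last inclusion takes the two copies of $\Sigma P$ to the first and the second copy of $Q$, in this order, and $\hat{\mathfrak F}_{n-1}$ to the second copy of $Q$. Then $\nu_n$ is a co-multiplication on $Q$ (the constant map is a two-sided homotopy co-unit), $\nu_n\circ e\simeq(e\vee e)\circ\sigma_{W^{n-1}\sqcup *}$, and $\nu_n$ is, up to pointed homotopy, the only map $\mu:Q\to Q\vee Q$ that corresponds to the group structure on $\tau_{W^{n-1}}$, that is, with $e^*[(f,g)\circ\mu]=e^*[f]\,e^*[g]$ in $\tau_{W^{n-1}}(X)$ for all pointed spaces $X$ and all $f,g:Q\to X$. -/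

import Mathlib

open scoped unitInterval

namespace FoxSpace

universe u v w x

noncomputable section

/-! ### Pointed spaces, pointed maps and pointed homotopy -/

/-- A pointed topological space. -/
structure PSpace : Type (u + 1) where
  /-- the underlying space -/
  carrier : Type u
  [top : TopologicalSpace carrier]
  /-- the base point -/
  pt : carrier

instance : CoeSort PSpace.{u} (Type u) := ⟨PSpace.carrier⟩

instance (X : PSpace.{u}) : TopologicalSpace X := X.top

/-- A base point preserving continuous map. -/
@[ext]
structure PMap (X : PSpace.{u}) (Y : PSpace.{v}) where
  /-- the underlying continuous map -/
  toMap : C(X, Y)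
  map_pt : toMap X.pt = Y.pt

namespace PMap

variable {X : PSpace.{u}} {Y : PSpace.{v}} {Z : PSpace.{w}}

/-- The identity. -/
def id (X : PSpace.{u}) : PMap X X := ⟨ContinuousMap.id X, rfl⟩

/-- The constant map at the base point. -/
def const (X : PSpace.{u}) (Y : PSpace.{v}) : PMap X Y := ⟨ContinuousMap.const X Y.pt, rfl⟩

/-- Composition `g ∘ f`. -/
def comp (g : PMap Y Z) (f : PMap X Y) : PMap X Z :=
  ⟨g.toMap.comp f.toMap, by
    rw [ContinuousMap.comp_apply, f.map_pt, g.map_pt]⟩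

/-- Base point preserving homotopy. -/
def Homotopic (f g : PMap X Y) : Prop := f.toMap.HomotopicRel g.toMap {X.pt}

theorem Homotopic.comp {g g' : PMap Y Z} {f f' : PMap X Y} (hg : g.Homotopic g')
    (hf : f.Homotopic f') : (g.comp f).Homotopic (g'.comp f') := by
  obtain ⟨G⟩ := hg
  obtain ⟨F⟩ := hf
  refine ⟨⟨⟨⟨fun p => G (p.1, F p), by fun_prop⟩, ?_, ?_⟩, ?_⟩⟩
  · intro a
    simp [PMap.comp]
  · intro a
    simp [PMap.comp]
  · intro t a ha
    obtain rfl : a = X.pt := ha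
    have h1 : F (t, X.pt) = f.toMap X.pt := F.eq_fst t rfl
    have h2 : G (t, Y.pt) = g.toMap Y.pt := G.eq_fst t rfl
    simp [PMap.comp, h1, f.map_pt, h2]

/-- Base point preserving homotopy as an equivalence relation. -/
instance homotopySetoid (X : PSpace.{u}) (Y : PSpace.{v}) : Setoid (PMap X Y) where
  r := Homotopic
  iseqv :=
    ⟨fun f => ContinuousMap.HomotopicRel.refl f.toMap, fun h => ContinuousMap.HomotopicRel.symm h,
      fun h h' => ContinuousMap.HomotopicRel.trans h h'⟩

/-- A pointed map is a pointed homotopy equivalence. -/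
def IsHomotopyEquiv (f : PMap X Y) : Prop :=
  ∃ g : PMap Y X, (g.comp f).Homotopic (id X) ∧ (f.comp g).Homotopic (id Y)

end PMap

/-- The set `[X, Y]` of pointed homotopy classes of pointed maps. -/
def HClass (X : PSpace.{u}) (Y : PSpace.{v}) := Quotient (PMap.homotopySetoid X Y)

/-- The pointed homotopy class of a pointed map. -/
def HClass.mk {X : PSpace.{u}} {Y : PSpace.{v}} (f : PMap X Y) : HClass X Y :=
  Quotient.mk (PMap.homotopySetoid X Y) f

/-! ### Quotients that collapse a subset to a point -/

/-- The equivalence relation that identifies all points of `A`. -/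
def collapseSetoid {X : Type u} (A : Set X) : Setoid X where
  r x y := x = y ∨ (x ∈ A ∧ y ∈ A)
  iseqv := by
    refine ⟨fun x => Or.inl rfl, ?_, ?_⟩
    · rintro x y (rfl | h)
      · exact Or.inl rfl
      · exact Or.inr h.symm
    · rintro x y z (rfl | h) (rfl | h')
      · exact Or.inl rfl
      · exact Or.inr h'
      · exact Or.inr h
      · exact Or.inr ⟨h.1, h'.2⟩

/-- The quotient space `X / A`. -/
def Collapse {X : Type u} (A : Set X) : Type u := Quotient (collapseSetoid A)

namespace Collapse

variable {X : Type u} [TopologicalSpace X] {A : Set X}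

instance (A : Set X) : TopologicalSpace (Collapse A) :=
  inferInstanceAs (TopologicalSpace (Quotient (collapseSetoid A)))

/-- The quotient map `X → X / A`. -/
def mk (A : Set X) : C(X, Collapse A) :=
  ⟨Quotient.mk (collapseSetoid A), continuous_quotient_mk'⟩

theorem isQuotientMap_mk (A : Set X) : Topology.IsQuotientMap (mk A) := isQuotientMap_quotient_mk'

theorem mk_eq {a b : X} (ha : a ∈ A) (hb : b ∈ A) : mk A a = mk A b :=
  Quotient.sound (s := collapseSetoid A) (Or.inr ⟨ha, hb⟩)

/-- The map on `X / A` induced by a map that is constant on `A`. -/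
def lift {Y : Type v} [TopologicalSpace Y] (f : C(X, Y)) (h : ∀ a ∈ A, ∀ b ∈ A, f a = f b) :
    C(Collapse A, Y) :=
  ⟨Quotient.lift (s := collapseSetoid A) f (by
      rintro a b (rfl | hab)
      · rfl
      · exact h a hab.1 b hab.2),
    f.continuous.quotient_lift _⟩

@[simp]
theorem lift_mk {Y : Type v} [TopologicalSpace Y] (f : C(X, Y))
    (h : ∀ a ∈ A, ∀ b ∈ A, f a = f b) (a : X) : lift f h (mk A a) = f a := rfl

end Collapse

/-! ### Wedges -/

/-- The wedge `X ∨ Y`. -/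
def Wedge (X : PSpace.{u}) (Y : PSpace.{v}) : PSpace.{max u v} where
  carrier := Collapse ({Sum.inl X.pt, Sum.inr Y.pt} : Set (X ⊕ Y))
  pt := Collapse.mk _ (Sum.inl X.pt)

namespace Wedge

variable {X : PSpace.{u}} {Y : PSpace.{v}} {Z : PSpace.{w}} {T : PSpace.{x}}

/-- The inclusion of the first summand. -/
def inl (X : PSpace.{u}) (Y : PSpace.{v}) : PMap X (Wedge X Y) :=
  ⟨(Collapse.mk _).comp ⟨Sum.inl, continuous_inl⟩, rfl⟩

/-- The inclusion of the second summand. -/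
def inr (X : PSpace.{u}) (Y : PSpace.{v}) : PMap Y (Wedge X Y) :=
  ⟨(Collapse.mk _).comp ⟨Sum.inr, continuous_inr⟩, Collapse.mk_eq (by simp) (by simp)⟩

/-- The map `X ∨ Y → Z` that is `f` on `X` and `g` on `Y`. -/
def desc (f : PMap X Z) (g : PMap Y Z) : PMap (Wedge X Y) Z :=
  ⟨Collapse.lift ⟨Sum.elim f.toMap g.toMap, by fun_prop⟩ (by
      rintro a (rfl | rfl) b (rfl | rfl) <;> simp [f.map_pt, g.map_pt]), f.map_pt⟩

/-- The wedge `f ∨ g` of two maps. -/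
def map {X' : PSpace.{u}} {Y' : PSpace.{v}} (f : PMap X X') (g : PMap Y Y') :
    PMap (Wedge X Y) (Wedge X' Y') :=
  desc ((inl X' Y').comp f) ((inr X' Y').comp g)

theorem desc_homotopic {f f' : PMap X Z} {g g' : PMap Y Z} (hf : f.Homotopic f')
    (hg : g.Homotopic g') : (desc f g).Homotopic (desc f' g') := by
  obtain ⟨F⟩ := hf
  obtain ⟨G⟩ := hg
  have hF : ∀ t, F (t, X.pt) = Z.pt := fun t => (F.eq_fst t rfl).trans f.map_pt
  have hG : ∀ t, G (t, Y.pt) = Z.pt := fun t => (G.eq_fst t rfl).trans g.map_pt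
  let S : Set (X ⊕ Y) := {Sum.inl X.pt, Sum.inr Y.pt}
  let K : I × Collapse S → Z := fun q =>
    Quotient.lift (s := collapseSetoid S)
      (fun p => Sum.elim (fun a => F (q.1, a)) (fun b => G (q.1, b)) p) (by
        rintro p p' (rfl | ⟨rfl | rfl, rfl | rfl⟩) <;> simp [hF, hG]) q.2
  have hK : Continuous K := by
    refine (Collapse.isQuotientMap_mk S).continuous_lift_prod_right (Y := I) (g := K) ?_
    have h1 : Continuous fun p : (X ⊕ Y) × I =>
        Sum.elim (fun a => F (p.2, a)) (fun b => G (p.2, b)) p.1 := by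
      refine Topology.IsQuotientMap.continuous_lift_prod_left (Y := I) (X₀ := X ⊕ Y) (f := _root_.id)
        Topology.IsQuotientMap.id ?_
      rw [← (Homeomorph.sumProdDistrib (X := X) (Y := Y) (Z := I)).symm.comp_continuous_iff']
      refine continuous_sum_dom.2 ⟨?_, ?_⟩
      · exact (by fun_prop : Continuous fun p : X × I => F (p.2, p.1))
      · exact (by fun_prop : Continuous fun p : Y × I => G (p.2, p.1))
    exact h1.comp continuous_swap
  refine ⟨⟨⟨⟨K, hK⟩, ?_, ?_⟩, ?_⟩⟩
  · intro p
    obtain ⟨p, rfl⟩ := (Collapse.isQuotientMap_mk S).surjective p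
    rcases p with a | b
    · exact F.apply_zero a
    · exact G.apply_zero b
  · intro p
    obtain ⟨p, rfl⟩ := (Collapse.isQuotientMap_mk S).surjective p
    rcases p with a | b
    · exact F.apply_one a
    · exact G.apply_one b
  · rintro t p rfl
    exact (hF t).trans f.map_pt.symm

end Wedge

/-! ### Reduced suspensions and the groups `[ΣA, X]` -/

/-- The subset of `A × [0,1]` that is collapsed in the reduced suspension. -/
def suspSet (A : PSpace.{u}) : Set (A × I) := {p | p.1 = A.pt ∨ p.2 = 0 ∨ p.2 = 1}

/-- The reduced suspension `ΣA`. -/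
def Susp (A : PSpace.{u}) : PSpace.{u} where
  carrier := Collapse (suspSet A)
  pt := Collapse.mk _ (A.pt, 0)

/-- The affine function `t ↦ c t + d`, cut off to `[0,1]`. -/
def clamp (c d : ℝ) : C(I, I) :=
  ⟨fun t => Set.projIcc 0 1 zero_le_one (c * (t : ℝ) + d), by fun_prop⟩

namespace Susp

variable {A : PSpace.{u}} {B : PSpace.{v}} {X : PSpace.{w}}

/-- The point `[a, t]` of `ΣA`. -/
def point (a : A) (t : I) : Susp A := Collapse.mk (suspSet A) (a, t)

theorem point_eq_pt {a : A} {t : I} (h : a = A.pt ∨ t = 0 ∨ t = 1) : point a t = (Susp A).pt :=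
  Collapse.mk_eq h (Or.inl rfl)

theorem continuous_point : Continuous fun p : A × I => point p.1 p.2 :=
  (Collapse.mk (suspSet A)).continuous

/-- The pointed map on `ΣA` given by a map on `A × [0,1]`. -/
def lift (f : C(A × I, X)) (h : ∀ a t, (a = A.pt ∨ t = 0 ∨ t = 1) → f (a, t) = X.pt) :
    PMap (Susp A) X :=
  ⟨Collapse.lift f fun p hp q hq => (h p.1 p.2 hp).trans (h q.1 q.2 hq).symm,
    h A.pt 0 (Or.inl rfl)⟩

/-- The suspension `Σf`. -/
def map (f : PMap A B) : PMap (Susp A) (Susp B) :=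
  lift ⟨fun p => point (f.toMap p.1) p.2,
      continuous_point.comp (by fun_prop : Continuous fun p : A × I => (f.toMap p.1, p.2))⟩ (by
    rintro a t (rfl | h)
    · exact point_eq_pt (Or.inl f.map_pt)
    · exact point_eq_pt (Or.inr h))

theorem clamp_of_le {c d : ℝ} {t : I} (h : c * (t : ℝ) + d ≤ 0) : clamp c d t = 0 :=
  Set.projIcc_of_le_left zero_le_one h

theorem clamp_of_ge {c d : ℝ} {t : I} (h : 1 ≤ c * (t : ℝ) + d) : clamp c d t = 1 :=
  Set.projIcc_of_right_le zero_le_one h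

/-- The suspension co-multiplication `ΣA → ΣA ∨ ΣA`: it sends `[a, t]` to the point `[a, 2t]` of
the first summand if `t ≤ 1/2`, and to the point `[a, 2t - 1]` of the second one if `t ≥ 1/2`. -/
def comul (A : PSpace.{u}) : PMap (Susp A) (Wedge (Susp A) (Susp A)) :=
  lift
    ⟨fun p => if (p.2 : ℝ) ≤ 1 / 2 then (Wedge.inl (Susp A) (Susp A)).toMap (point p.1 (clamp 2 0 p.2))
        else (Wedge.inr (Susp A) (Susp A)).toMap (point p.1 (clamp 2 (-1) p.2)), by
      refine Continuous.if_le ?_ ?_ (by fun_prop) continuous_const ?_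
      · exact (Wedge.inl (Susp A) (Susp A)).toMap.continuous.comp (continuous_point.comp
          (by fun_prop : Continuous fun p : A × I => (p.1, clamp 2 0 p.2)))
      · exact (Wedge.inr (Susp A) (Susp A)).toMap.continuous.comp (continuous_point.comp
          (by fun_prop : Continuous fun p : A × I => (p.1, clamp 2 (-1) p.2)))
      · intro p hp
        rw [clamp_of_ge (by rw [hp]; norm_num), clamp_of_le (by rw [hp]; norm_num),
          point_eq_pt (Or.inr (Or.inr rfl)), point_eq_pt (Or.inr (Or.inl rfl)), PMap.map_pt,
          PMap.map_pt]⟩ (by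
    rintro a t h
    have h1 : (Wedge.inl (Susp A) (Susp A)).toMap (Susp A).pt = (Wedge (Susp A) (Susp A)).pt :=
      PMap.map_pt _
    have h2 : (Wedge.inr (Susp A) (Susp A)).toMap (Susp A).pt = (Wedge (Susp A) (Susp A)).pt :=
      PMap.map_pt _
    rcases h with rfl | rfl | rfl
    · simp [point_eq_pt (Or.inl rfl), h1, h2]
    · simp [clamp_of_le, point_eq_pt, h1]
    · have h3 : ¬ ((1 : ℝ) ≤ 2⁻¹) := by norm_num
      have h4 : clamp 2 (-1) 1 = 1 := clamp_of_ge (by norm_num)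
      simp [h3, h4, point_eq_pt, h2])

/-- The map `[a, t] ↦ [a, φ t]`, for a self map `φ` of `[0,1]` that preserves `{0, 1}`. -/
def reparam (A : PSpace.{u}) (φ : C(I, I)) (h0 : φ 0 = 0 ∨ φ 0 = 1) (h1 : φ 1 = 0 ∨ φ 1 = 1) :
    PMap (Susp A) (Susp A) :=
  lift ⟨fun p => point p.1 (φ p.2),
      continuous_point.comp (by fun_prop : Continuous fun p : A × I => (p.1, φ p.2))⟩ (by
    rintro a t (rfl | rfl | rfl)
    · exact point_eq_pt (Or.inl rfl)
    · exact point_eq_pt (Or.inr h0)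
    · exact point_eq_pt (Or.inr h1))

/-- The co-inverse `[a, t] ↦ [a, 1 - t]` of `ΣA`. -/
def rev (A : PSpace.{u}) : PMap (Susp A) (Susp A) :=
  reparam A ⟨unitInterval.symm, unitInterval.continuous_symm⟩ (by simp) (by simp)

/-- Two maps on `ΣA` agree if they agree on all points `[a, t]`. -/
theorem hom_ext {f g : PMap (Susp A) X} (h : ∀ a t, f.toMap (point a t) = g.toMap (point a t)) :
    f = g := by
  ext p
  obtain ⟨⟨a, t⟩, rfl⟩ := (Collapse.isQuotientMap_mk (suspSet A)).surjective p
  exact h a t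

theorem reparam_homotopic {φ ψ : C(I, I)} (h0 : φ 0 = 0 ∨ φ 0 = 1) (h1 : φ 1 = 0 ∨ φ 1 = 1)
    (h0' : ψ 0 = φ 0) (h1' : ψ 1 = φ 1) :
    (reparam A φ h0 h1).Homotopic
      (reparam A ψ (by rwa [h0']) (by rwa [h1'])) := by
  let θ : C(I × I, I) := ⟨fun q => Set.projIcc 0 1 zero_le_one
    ((1 - (q.1 : ℝ)) * (φ q.2 : ℝ) + (q.1 : ℝ) * (ψ q.2 : ℝ)), by fun_prop⟩
  have θ0 : ∀ t, θ (0, t) = φ t := by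
    intro t
    simp [θ]
  have θ1 : ∀ t, θ (1, t) = ψ t := by
    intro t
    simp [θ]
  have θe : ∀ s t, ψ t = φ t → θ (s, t) = φ t := by
    intro s t h
    have : (1 - (s : ℝ)) * (φ t : ℝ) + (s : ℝ) * (φ t : ℝ) = (φ t : ℝ) := by ring
    simp [θ, h, this]
  let F : (I × (A × I)) → Susp A := fun q => point q.2.1 (θ (q.1, q.2.2))
  have hF : Continuous F := continuous_point.comp
    (by fun_prop : Continuous fun q : I × (A × I) => (q.2.1, θ (q.1, q.2.2)))
  have key : ∀ s a t, (a = A.pt ∨ t = 0 ∨ t = 1) → F (s, (a, t)) = (Susp A).pt := by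
    rintro s a t (rfl | rfl | rfl)
    · exact point_eq_pt (Or.inl rfl)
    · exact point_eq_pt (Or.inr (by rw [θe s 0 h0']; exact h0))
    · exact point_eq_pt (Or.inr (by rw [θe s 1 h1']; exact h1))
  let G : I × Susp A → Susp A := fun q =>
    Quotient.lift (s := collapseSetoid (suspSet A)) (fun p => F (q.1, p)) (by
      rintro p p' (rfl | ⟨hp, hp'⟩)
      · rfl
      · exact (key q.1 p.1 p.2 hp).trans (key q.1 p'.1 p'.2 hp').symm) q.2
  have hG : Continuous G :=
    (Collapse.isQuotientMap_mk (suspSet A)).continuous_lift_prod_right (Y := I) (g := G) hF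
  refine ⟨⟨⟨⟨G, hG⟩, ?_, ?_⟩, ?_⟩⟩
  · intro p
    obtain ⟨⟨a, t⟩, rfl⟩ := (Collapse.isQuotientMap_mk (suspSet A)).surjective p
    change point a (θ (0, t)) = point a (φ t)
    rw [θ0]
  · intro p
    obtain ⟨⟨a, t⟩, rfl⟩ := (Collapse.isQuotientMap_mk (suspSet A)).surjective p
    change point a (θ (1, t)) = point a (ψ t)
    rw [θ1]
  · rintro s p rfl
    change F (s, (A.pt, 0)) = point A.pt (φ 0)
    rw [key s A.pt 0 (Or.inl rfl), point_eq_pt (Or.inl rfl)]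

/-- The product `(f, g) ∘ comul` of two maps on `ΣA`. -/
def mul (f g : PMap (Susp A) X) : PMap (Susp A) X := (Wedge.desc f g).comp (comul A)

theorem mul_point (f g : PMap (Susp A) X) (a : A) (t : I) :
    (mul f g).toMap (point a t) = if (t : ℝ) ≤ 1 / 2 then f.toMap (point a (clamp 2 0 t))
      else g.toMap (point a (clamp 2 (-1) t)) := by
  change (Wedge.desc f g).toMap (if (t : ℝ) ≤ 1 / 2 then _ else _) = _
  split_ifs <;> rfl

theorem reparam_point (φ : C(I, I)) (h0 : φ 0 = 0 ∨ φ 0 = 1) (h1 : φ 1 = 0 ∨ φ 1 = 1) (a : A)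
    (t : I) : (reparam A φ h0 h1).toMap (point a t) = point a (φ t) := rfl

theorem const_point (a : A) (t : I) : (PMap.const (Susp A) X).toMap (point a t) = X.pt := rfl

theorem apply_pt (f : PMap (Susp A) X) {a : A} {t : I} (h : t = 0 ∨ t = 1) :
    f.toMap (point a t) = X.pt := by
  rw [point_eq_pt (Or.inr h), f.map_pt]

theorem mul_homotopic {f f' g g' : PMap (Susp A) X} (hf : f.Homotopic f') (hg : g.Homotopic g') :
    (mul f g).Homotopic (mul f' g') :=
  (Wedge.desc_homotopic hf hg).comp (ContinuousMap.HomotopicRel.refl _)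

theorem id_eq_reparam : PMap.id (Susp A) = reparam A (ContinuousMap.id I) (by simp) (by simp) :=
  hom_ext fun _ _ => rfl

theorem comp_reparam_homotopic (f : PMap (Susp A) X) {φ : C(I, I)} (h0 : φ 0 = 0) (h1 : φ 1 = 1) :
    (f.comp (reparam A φ (Or.inl h0) (Or.inr h1))).Homotopic f := by
  have h := reparam_homotopic (A := A) (φ := φ) (ψ := ContinuousMap.id I) (Or.inl h0) (Or.inr h1)
    (by simp [h0]) (by simp [h1])
  rw [← id_eq_reparam] at h
  exact PMap.Homotopic.comp (ContinuousMap.HomotopicRel.refl f.toMap) h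

theorem coe_clamp {c d : ℝ} {t : I} (h0 : 0 ≤ c * (t : ℝ) + d) (h1 : c * (t : ℝ) + d ≤ 1) :
    (clamp c d t : ℝ) = c * (t : ℝ) + d := by
  change ((Set.projIcc (0 : ℝ) 1 zero_le_one (c * (t : ℝ) + d) : I) : ℝ) = _
  rw [Set.projIcc_of_mem zero_le_one ⟨h0, h1⟩]

theorem coe_clamp_eq {c d s : ℝ} {t : I} (hs : (t : ℝ) = s) (h0 : 0 ≤ c * s + d)
    (h1 : c * s + d ≤ 1) : (clamp c d t : ℝ) = c * s + d := by
  subst hs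
  exact coe_clamp h0 h1

theorem one_mul_homotopic (f : PMap (Susp A) X) :
    (mul (PMap.const (Susp A) X) f).Homotopic f := by
  have h := comp_reparam_homotopic f (φ := clamp 2 (-1)) (clamp_of_le (by norm_num))
    (clamp_of_ge (by norm_num))
  convert h using 1
  refine hom_ext fun a t => ?_
  rw [mul_point]
  change _ = f.toMap (point a (clamp 2 (-1) t))
  split_ifs with ht
  · rw [clamp_of_le (c := 2) (d := -1) (by linarith), apply_pt f (Or.inl rfl), const_point]
  · rfl

theorem rev_mul_homotopic (f : PMap (Susp A) X) :
    (mul (f.comp (rev A)) f).Homotopic (PMap.const (Susp A) X) := by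
  let φ : C(I, I) := ⟨fun t => Set.projIcc 0 1 zero_le_one |2 * (t : ℝ) - 1|, by fun_prop⟩
  have hφ : ∀ t : I, (φ t : ℝ) = |2 * (t : ℝ) - 1| := by
    intro t
    change ((Set.projIcc (0 : ℝ) 1 zero_le_one _ : I) : ℝ) = _
    rw [Set.projIcc_of_mem zero_le_one ⟨abs_nonneg _, ?_⟩]
    rw [abs_le]
    constructor <;> linarith [t.2.1, t.2.2]
  have h0 : φ 0 = 1 := by
    apply Subtype.ext
    rw [hφ]
    norm_num
  have h1 : φ 1 = 1 := by
    apply Subtype.ext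
    rw [hφ]
    norm_num
  have h := reparam_homotopic (A := A) (φ := φ) (ψ := ContinuousMap.const I 1) (Or.inr h0)
    (Or.inr h1) (by simp [h0]) (by simp [h1])
  have h' := PMap.Homotopic.comp (ContinuousMap.HomotopicRel.refl f.toMap : f.Homotopic f) h
  convert h' using 1
  · refine hom_ext fun a t => ?_
    rw [mul_point]
    change _ = f.toMap (point a (φ t))
    split_ifs with ht
    · change f.toMap (point a (unitInterval.symm (clamp 2 0 t))) = _
      congr 2
      apply Subtype.ext
      rw [hφ, unitInterval.coe_symm_eq, coe_clamp (by linarith [t.2.1]) (by linarith),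
        abs_of_nonpos (by linarith)]
      ring
    · congr 2
      apply Subtype.ext
      push Not at ht
      rw [hφ, coe_clamp (by linarith) (by linarith [t.2.2]), abs_of_nonneg (by linarith)]
      ring
  · refine hom_ext fun a t => ?_
    change _ = f.toMap (point a 1)
    rw [const_point, apply_pt f (Or.inr rfl)]

theorem mul_assoc_homotopic (f g h : PMap (Susp A) X) :
    (mul (mul f g) h).Homotopic (mul f (mul g h)) := by
  let φ : C(I, I) := ⟨fun t => Set.projIcc 0 1 zero_le_one
    (min (min (2 * (t : ℝ)) (t + 1 / 4)) ((t + 1) / 2)), by fun_prop⟩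
  have hφ : ∀ t : I, (φ t : ℝ) = min (min (2 * (t : ℝ)) (t + 1 / 4)) ((t + 1) / 2) := by
    intro t
    change ((Set.projIcc (0 : ℝ) 1 zero_le_one _ : I) : ℝ) = _
    rw [Set.projIcc_of_mem zero_le_one ⟨?_, ?_⟩]
    · have := t.2.1
      refine le_min (le_min ?_ ?_) ?_ <;> linarith
    · exact (min_le_right _ _).trans (by linarith [t.2.2])
  have hφ1 : ∀ t : I, (t : ℝ) ≤ 1 / 4 → (φ t : ℝ) = 2 * t := by
    intro t ht
    rw [hφ, min_eq_left (by linarith : 2 * (t : ℝ) ≤ t + 1 / 4), min_eq_left (by linarith)]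
  have hφ2 : ∀ t : I, 1 / 4 ≤ (t : ℝ) → (t : ℝ) ≤ 1 / 2 → (φ t : ℝ) = t + 1 / 4 := by
    intro t ht ht'
    rw [hφ, min_eq_right (by linarith : (t : ℝ) + 1 / 4 ≤ 2 * t), min_eq_left (by linarith)]
  have hφ3 : ∀ t : I, 1 / 2 ≤ (t : ℝ) → (φ t : ℝ) = (t + 1) / 2 := by
    intro t ht
    rw [hφ, min_eq_right (by linarith : (t : ℝ) + 1 / 4 ≤ 2 * t), min_eq_right (by linarith)]
  have h0 : φ 0 = 0 := by
    apply Subtype.ext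
    rw [hφ1 0 (by norm_num)]
    norm_num
  have h1 : φ 1 = 1 := by
    apply Subtype.ext
    rw [hφ3 1 (by norm_num)]
    norm_num
  have H := comp_reparam_homotopic (mul f (mul g h)) h0 h1
  convert H using 1
  refine hom_ext fun a t => ?_
  change _ = (mul f (mul g h)).toMap (point a (φ t))
  have hb := t.2
  rw [mul_point, mul_point f (mul g h)]
  by_cases ht : (t : ℝ) ≤ 1 / 2
  · have hc : (clamp 2 0 t : ℝ) = 2 * t + 0 := coe_clamp (by linarith [hb.1]) (by linarith)
    rw [if_pos ht, mul_point]
    by_cases ht' : (t : ℝ) ≤ 1 / 4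
    · have e := hφ1 t ht'
      rw [if_pos (by rw [hc]; linarith), if_pos (by rw [e]; linarith)]
      congr 2
      apply Subtype.ext
      refine (coe_clamp_eq hc (by linarith [hb.1]) (by linarith)).trans
        (Eq.trans ?_ (coe_clamp_eq e (by linarith [hb.1]) (by linarith)).symm)
      ring
    · push Not at ht'
      have e := hφ2 t ht'.le ht
      have e' : (clamp 2 (-1) (φ t) : ℝ) = 2 * (t + 1 / 4) + -1 :=
        coe_clamp_eq e (by linarith) (by linarith)
      rw [if_neg (by rw [hc]; linarith), if_neg (by rw [e]; linarith), mul_point,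
        if_pos (by rw [e']; linarith)]
      congr 2
      apply Subtype.ext
      refine (coe_clamp_eq hc (by linarith) (by linarith)).trans
        (Eq.trans ?_ (coe_clamp_eq e' (by linarith) (by linarith)).symm)
      ring
  · push Not at ht
    have e := hφ3 t ht.le
    have e' : (clamp 2 (-1) (φ t) : ℝ) = 2 * ((t + 1) / 2) + -1 :=
      coe_clamp_eq e (by linarith) (by linarith [hb.2])
    rw [if_neg (by linarith), if_neg (by rw [e]; linarith), mul_point,
      if_neg (by rw [e']; linarith)]
    congr 2
    apply Subtype.ext
    refine (coe_clamp (by linarith) (by linarith [hb.2])).trans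
      (Eq.trans ?_ (coe_clamp_eq e' (by linarith) (by linarith [hb.2])).symm)
    ring

/-- The group `[ΣA, X]`: the product of `[f]` and `[g]` is the class of `(f, g) ∘ comul`, the map
that runs through `f` and then through `g`. -/
instance (A : PSpace.{u}) (X : PSpace.{v}) : Group (HClass (Susp A) X) :=
  letI : Mul (HClass (Susp A) X) :=
    ⟨Quotient.map₂ mul fun _ _ hf _ _ hg => mul_homotopic hf hg⟩
  letI : One (HClass (Susp A) X) := ⟨HClass.mk (PMap.const (Susp A) X)⟩
  letI : Inv (HClass (Susp A) X) :=
    ⟨Quotient.map (fun f => f.comp (rev A)) fun _ _ hf =>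
      PMap.Homotopic.comp hf (ContinuousMap.HomotopicRel.refl _)⟩
  Group.ofLeftAxioms
    (by
      rintro ⟨f⟩ ⟨g⟩ ⟨h⟩
      exact Quotient.sound (mul_assoc_homotopic f g h))
    (by
      rintro ⟨f⟩
      exact Quotient.sound (one_mul_homotopic f))
    (by
      rintro ⟨f⟩
      exact Quotient.sound (rev_mul_homotopic f))

theorem mk_mul (f g : PMap (Susp A) X) :
    HClass.mk f * HClass.mk g = HClass.mk ((Wedge.desc f g).comp (comul A)) := rfl

theorem mk_inv (f : PMap (Susp A) X) : (HClass.mk f)⁻¹ = HClass.mk (f.comp (rev A)) := rfl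

end Susp

/-! ### Well-pointed spaces -/

/-- The space `W` is well-pointed at `w₀`: the inclusion of `w₀` is a cofibration, that is, it has
the homotopy extension property with respect to all spaces. -/
def WellPointed (W : Type u) [TopologicalSpace W] (w₀ : W) : Prop :=
  ∀ (Y : Type u) [TopologicalSpace Y] (f : C(W, Y)) (γ : C(I, Y)), γ 0 = f w₀ →
    ∃ H : C(W × I, Y), (∀ a, H (a, 0) = f a) ∧ ∀ t, H (w₀, t) = γ t

/-! ### Fox spaces, pinched spaces and the co-multiplication -/

/-- `Y ⊔ *`, the space `Y` with a disjoint base point. -/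
def Plus (Y : Type u) [TopologicalSpace Y] : PSpace.{u} where
  carrier := Y ⊕ Unit
  pt := Sum.inr ()

section Fox

variable (W : Type u) [TopologicalSpace W] (w₀ : W)

/-- The space `F̂_n(W) = Σ(W^(n-1) ⊔ *)`, for `n ≥ 1`. -/
def Fox (n : ℕ) : PSpace.{u} := Susp (Plus (Fin (n - 1) → W))

/-- The `W^(n-1)`-Fox group `τ_{W^(n-1)}(X) = [Σ(W^(n-1) ⊔ *), X]`, with the group structure of the
homotopy classes of maps on a suspension. -/
abbrev FoxGroup (n : ℕ) (X : PSpace.{v}) : Type (max u v) :=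
  HClass (Susp (Plus (Fin (n - 1) → W))) X

/-- The subspace `W^(k-1) = {x | x_k = w₀}` of `W^k`, for `k ≥ 1`. -/
def lastAtBase (k : ℕ) : Set (Fin k → W) := {x | ∀ i : Fin k, i.val + 1 = k → x i = w₀}

/-- The `k`-fold pinched space `P_k(W) = W^k / W^(k-1)`, for `k ≥ 1`. -/
def Pinched (k : ℕ) : PSpace.{u} where
  carrier := Collapse (lastAtBase W w₀ k)
  pt := Collapse.mk _ fun _ => w₀

/-- The pinch map `W^k ⊔ * → P_k(W)`. -/
def pinch (k : ℕ) : PMap (Plus (Fin k → W)) (Pinched W w₀ k) :=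
  ⟨⟨Sum.elim (Collapse.mk (lastAtBase W w₀ k)) fun _ => (Pinched W w₀ k).pt,
    (Collapse.mk (lastAtBase W w₀ k)).continuous.sumElim continuous_const⟩, rfl⟩

/-- The projection `W^k ⊔ * → W^(k-1) ⊔ *` that forgets the last coordinate, for `k ≥ 1`. -/
def proj (k : ℕ) : PMap (Plus (Fin k → W)) (Plus (Fin (k - 1) → W)) :=
  ⟨⟨Sum.map (fun x i => x (Fin.castLE (Nat.sub_le k 1) i)) _root_.id,
    Continuous.sumMap (by fun_prop) continuous_id⟩, rfl⟩

/-- `ΣP_(n-1)(W) ∨ F̂_(n-1)(W)`. -/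
abbrev FoxWedge (n : ℕ) : PSpace.{u} :=
  Wedge (Susp (Pinched W w₀ (n - 1))) (Fox W (n - 1))

/-- `Σq : F̂_n(W) → ΣP_(n-1)(W)`, the suspension of the pinch map. -/
def foxPinch (n : ℕ) : PMap (Fox W n) (Susp (Pinched W w₀ (n - 1))) :=
  Susp.map (pinch W w₀ (n - 1))

/-- `Σp : F̂_n(W) → F̂_(n-1)(W)`, the suspension of the projection. -/
def foxProj (n : ℕ) : PMap (Fox W n) (Fox W (n - 1)) :=
  Susp.map (proj W (n - 1))

/-- The map `F̂_n(W) → ΣP_(n-1)(W) ∨ F̂_(n-1)(W)` that represents the natural map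
`[ΣP_(n-1)(W), X] × [F̂_(n-1)(W), X] → [F̂_n(W), X]`, `(a, b) ↦ p^*(b) q^*(a)`: it runs through
`Σp` and then through `Σq`. -/
def foxSplit (n : ℕ) : PMap (Fox W n) (FoxWedge W w₀ n) :=
  (Wedge.desc
    ((Wedge.inr (Susp (Pinched W w₀ (n - 1))) (Fox W (n - 1))).comp (foxProj W n))
    ((Wedge.inl (Susp (Pinched W w₀ (n - 1))) (Fox W (n - 1))).comp (foxPinch W w₀ n))).comp
  (Susp.comul (Plus (Fin (n - 1) → W)))

/-- `α : ΣP_(n-1)(W) → F̂_(n-1)(W) ∨ ΣP_(n-1)(W)` is a co-action map: its class is the value at the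
two inclusions `(b, a)` of the action `a · b = b⁻¹ a b` of `[F̂_(n-1)(W), X]` on
`[ΣP_(n-1)(W), X]`, both seen in `τ_{W^(n-1)}(X)`, for `X = F̂_(n-1)(W) ∨ ΣP_(n-1)(W)`. -/
def IsCoaction (n : ℕ)
    (α : PMap (Susp (Pinched W w₀ (n - 1)))
      (Wedge (Fox W (n - 1)) (Susp (Pinched W w₀ (n - 1))))) : Prop :=
  let b : FoxGroup W n (Wedge (Fox W (n - 1)) (Susp (Pinched W w₀ (n - 1)))) :=
    HClass.mk ((Wedge.inl _ _).comp (foxProj W n))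
  let a : FoxGroup W n (Wedge (Fox W (n - 1)) (Susp (Pinched W w₀ (n - 1)))) :=
    HClass.mk ((Wedge.inr _ _).comp (foxPinch W w₀ n))
  HClass.mk (α.comp (foxPinch W w₀ n)) = b⁻¹ * a * b

/-- `ν¹ : F̂_(n-1) → F̂_(n-1) ∨ F̂_(n-1) ↪ Q ∨ Q`, where `Q = ΣP_(n-1) ∨ F̂_(n-1)` and the first map is
the suspension co-multiplication. -/
def foxComulOne (n : ℕ) :
    PMap (Fox W (n - 1)) (Wedge (FoxWedge W w₀ n) (FoxWedge W w₀ n)) :=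
  (Wedge.map (Wedge.inr (Susp (Pinched W w₀ (n - 1))) (Fox W (n - 1)))
    (Wedge.inr (Susp (Pinched W w₀ (n - 1))) (Fox W (n - 1)))).comp
  (Susp.comul (Plus (Fin (n - 1 - 1) → W)))

/-- The inclusion `(F̂_(n-1) ∨ ΣP_(n-1)) ∨ ΣP_(n-1) ↪ Q ∨ Q`, where `Q = ΣP_(n-1) ∨ F̂_(n-1)`: the two
copies of `ΣP_(n-1)` go, in this order, to the first and to the second copy of `Q`, and `F̂_(n-1)`
goes to the second copy of `Q`. -/
def foxIncl (n : ℕ) :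
    PMap (Wedge (Wedge (Fox W (n - 1)) (Susp (Pinched W w₀ (n - 1))))
        (Susp (Pinched W w₀ (n - 1))))
      (Wedge (FoxWedge W w₀ n) (FoxWedge W w₀ n)) :=
  Wedge.desc
    (Wedge.desc
      ((Wedge.inr (FoxWedge W w₀ n) (FoxWedge W w₀ n)).comp (Wedge.inr _ _))
      ((Wedge.inl (FoxWedge W w₀ n) (FoxWedge W w₀ n)).comp (Wedge.inl _ _)))
    ((Wedge.inr (FoxWedge W w₀ n) (FoxWedge W w₀ n)).comp (Wedge.inl _ _))

/-- `ν² : ΣP → ΣP ∨ ΣP → (F̂_(n-1) ∨ ΣP) ∨ ΣP ↪ Q ∨ Q`, where `P = P_(n-1)(W)`,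
`Q = ΣP ∨ F̂_(n-1)`, the first map is the suspension co-multiplication and the second is `α ∨ 1`. -/
def foxComulTwo (n : ℕ)
    (α : PMap (Susp (Pinched W w₀ (n - 1)))
      (Wedge (Fox W (n - 1)) (Susp (Pinched W w₀ (n - 1))))) :
    PMap (Susp (Pinched W w₀ (n - 1))) (Wedge (FoxWedge W w₀ n) (FoxWedge W w₀ n)) :=
  (foxIncl W w₀ n).comp
    ((Wedge.map α (PMap.id (Susp (Pinched W w₀ (n - 1))))).comp
      (Susp.comul (Pinched W w₀ (n - 1))))

/-- The map `ν_n : Q → Q ∨ Q` on `Q = ΣP_(n-1)(W) ∨ F̂_(n-1)(W)` that is `ν²` on the first summand and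
`ν¹` on the second one. -/
def foxComul (n : ℕ)
    (α : PMap (Susp (Pinched W w₀ (n - 1)))
      (Wedge (Fox W (n - 1)) (Susp (Pinched W w₀ (n - 1))))) :
    PMap (FoxWedge W w₀ n) (Wedge (FoxWedge W w₀ n) (FoxWedge W w₀ n)) :=
  Wedge.desc (foxComulTwo W w₀ n α) (foxComulOne W w₀ n)

end Fox

/-- A co-multiplication on `Q`: a map `Q → Q ∨ Q` for which the constant map is a two-sided co-unit
up to homotopy. -/
def IsComultiplication {Q : PSpace.{u}} (ν : PMap Q (Wedge Q Q)) : Prop :=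
  ((Wedge.desc (PMap.id Q) (PMap.const Q Q)).comp ν).Homotopic (PMap.id Q) ∧
    ((Wedge.desc (PMap.const Q Q) (PMap.id Q)).comp ν).Homotopic (PMap.id Q)

/-- Under `e : ΣA → Q`, the map `ν : Q → Q ∨ Q` corresponds to the group structure on `[ΣA, X]`, for
every pointed space `X`: the product `(f, g) ∘ ν` of two maps on `Q` goes to the product in
`[ΣA, X]`. -/
def InducesGroupStructure {A Q : PSpace.{u}} (e : PMap (Susp A) Q) (ν : PMap Q (Wedge Q Q)) :
    Prop :=
  ∀ (X : PSpace.{u}) (f g : PMap Q X),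
    HClass.mk (((Wedge.desc f g).comp ν).comp e) = HClass.mk (f.comp e) * HClass.mk (g.comp e)

end

end FoxSpace

/-!
A retraction `p` of a cofibration `i : B → A` with cofibre `q : A → C` makes
`1 → [ΣC, X] → [ΣA, X] → [ΣB, X] → 1` a split extension of groups, naturally in `X`: as `p ∘ i` is
the identity, `[Σ(i ∘ p)]⁻¹ [1]` dies on `ΣB`, and the homotopy extension property of `Σi` turns
it into a map `ΣC → ΣA` that is a section of `Σq` up to homotopy. Hence `(a, b) ↦ p^*(b) q^*(a)` is
a natural bijection, which by Yoneda is a homotopy equivalence, and conjugation by `p^*(b)` acts on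
the normal subgroup `[ΣC, X]`, which gives the co-action. The co-multiplication comes from
`(b₁ a₁) (b₂ a₂) = b₁ b₂ (b₂⁻¹ a₁ b₂) a₂`. If `W` is well-pointed, then the inclusion
`W^(k-1) ⊔ * → W^k ⊔ *` is a cofibration, because its extension problems are those of `{w₀} ⊂ W`
with `W^(k-1)` as a parameter.
-/

namespace FoxSpace

universe u v w x

/-! ### Homotopy classes and composition -/

namespace PMap

variable {X : PSpace.{u}} {Y : PSpace.{v}} {Z : PSpace.{w}}

theorem Homotopic.refl (f : PMap X Y) : f.Homotopic f :=
  ContinuousMap.HomotopicRel.refl f.toMap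

theorem homotopic_iff_exists {f g : PMap X Y} :
    f.Homotopic g ↔ ∃ F : C(I × X, Y), (∀ a, F (0, a) = f.toMap a) ∧
      (∀ a, F (1, a) = g.toMap a) ∧ ∀ t, F (t, X.pt) = Y.pt := by
  constructor
  · rintro ⟨F⟩
    exact ⟨F.toContinuousMap, F.apply_zero, F.apply_one,
      fun t => (F.eq_fst t rfl).trans f.map_pt⟩
  · rintro ⟨F, h0, h1, hpt⟩
    refine ⟨⟨⟨F, h0, h1⟩, ?_⟩⟩
    rintro t _ rfl
    exact (hpt t).trans f.map_pt.symm

theorem congr_apply {f g : PMap X Y} (h : f = g) (a : X) : f.toMap a = g.toMap a :=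
  h ▸ rfl

theorem comp_const (g : PMap Y Z) : g.comp (const X Y) = const X Z :=
  PMap.ext (ContinuousMap.ext fun _ => g.map_pt)

end PMap

namespace HClass

variable {X : PSpace.{u}} {Y : PSpace.{v}} {Z : PSpace.{w}}

theorem mk_eq_mk {f g : PMap X Y} : mk f = mk g ↔ f.Homotopic g :=
  ⟨fun h => Quotient.exact h, fun h => Quotient.sound h⟩

theorem exists_mk_eq (f : HClass X Y) : ∃ f', mk f' = f := Quotient.exists_rep f

/-- The map `e^* : [Y, Z] → [X, Z]`, `[f] ↦ [f ∘ e]`. -/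
def precomp (e : PMap X Y) (Z : PSpace.{w}) : HClass Y Z → HClass X Z :=
  Quotient.map (fun f => f.comp e) fun _ _ hf => PMap.Homotopic.comp hf (.refl e)

/-- The map `h_* : [X, Y] → [X, Z]`, `[f] ↦ [h ∘ f]`. -/
def postcomp (X : PSpace.{u}) (h : PMap Y Z) : HClass X Y → HClass X Z :=
  Quotient.map h.comp fun _ _ hf => PMap.Homotopic.comp (.refl h) hf

theorem isHomotopyEquiv_of_bijective_precomp {X Y : PSpace.{u}} {e : PMap X Y}
    (he : ∀ Z : PSpace.{u}, Function.Bijective (precomp e Z)) : e.IsHomotopyEquiv := by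
  obtain ⟨⟨g⟩, hg⟩ := (he X).surjective (mk (PMap.id X))
  refine ⟨g, mk_eq_mk.1 hg, mk_eq_mk.1 ((he Y).injective ?_)⟩
  exact congrArg (postcomp X e) hg

end HClass

namespace Wedge

variable {X : PSpace.{u}} {Y : PSpace.{v}} {Z : PSpace.{w}} {T : PSpace.{x}}

theorem hom_ext {f g : PMap (Wedge X Y) Z} (hl : f.comp (inl X Y) = g.comp (inl X Y))
    (hr : f.comp (inr X Y) = g.comp (inr X Y)) : f = g := by
  ext p
  obtain ⟨a | b, rfl⟩ := (Collapse.isQuotientMap_mk _).surjective p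
  · exact PMap.congr_apply hl a
  · exact PMap.congr_apply hr b

theorem desc_inl_inr : desc (inl X Y) (inr X Y) = PMap.id (Wedge X Y) :=
  hom_ext rfl rfl

theorem comp_desc (h : PMap Z T) (f : PMap X Z) (g : PMap Y Z) :
    h.comp (desc f g) = desc (h.comp f) (h.comp g) :=
  hom_ext rfl rfl

theorem bijective_precomp_inl_inr (X : PSpace.{u}) (Y : PSpace.{v}) (Z : PSpace.{w}) :
    Function.Bijective fun h : HClass (Wedge X Y) Z =>
      (HClass.precomp (inl X Y) Z h, HClass.precomp (inr X Y) Z h) := by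
  constructor
  · rintro ⟨f⟩ ⟨g⟩ h
    obtain ⟨hl, hr⟩ := Prod.mk.inj h
    have hfg := desc_homotopic (HClass.mk_eq_mk.1 hl) (HClass.mk_eq_mk.1 hr)
    rw [← comp_desc, ← comp_desc, desc_inl_inr] at hfg
    exact HClass.mk_eq_mk.2 hfg
  · rintro ⟨⟨f⟩, ⟨g⟩⟩
    exact ⟨HClass.mk (desc f g), rfl⟩

end Wedge

/-! ### Functoriality of the groups `[ΣA, X]` -/

namespace Susp

variable {A : PSpace.{u}} {B : PSpace.{v}} {X : PSpace.{w}} {Y : PSpace.{x}}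

theorem comp_mul (h : PMap X Y) (f g : PMap (Susp A) X) :
    h.comp (mul f g) = mul (h.comp f) (h.comp g) :=
  congrArg (fun k => PMap.comp k (comul A)) (Wedge.comp_desc h f g)

theorem mul_comp_map (f g : PMap (Susp B) X) (k : PMap A B) :
    (mul f g).comp (map k) = mul (f.comp (map k)) (g.comp (map k)) := by
  refine hom_ext fun a t => ?_
  rw [mul_point]
  exact mul_point f g (k.toMap a) t

theorem map_id : map (PMap.id A) = PMap.id (Susp A) := hom_ext fun _ _ => rfl

theorem map_comp_map {C : PSpace.{w}} (g : PMap B C) (f : PMap A B) :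
    (map g).comp (map f) = map (g.comp f) := hom_ext fun _ _ => rfl

theorem map_const : map (PMap.const A B) = PMap.const (Susp A) (Susp B) :=
  hom_ext fun _ _ => point_eq_pt (Or.inl rfl)

/-- The homomorphism `[ΣA, X] → [ΣA, Y]` induced by `h : X → Y`. -/
noncomputable def pushforward (A : PSpace.{u}) (h : PMap X Y) :
    HClass (Susp A) X →* HClass (Susp A) Y :=
  MonoidHom.mk' (HClass.postcomp (Susp A) h) (by
    rintro ⟨f⟩ ⟨g⟩
    exact congrArg HClass.mk (comp_mul h f g))

/-- The homomorphism `k^* : [ΣB, X] → [ΣA, X]` induced by `Σk`, for `k : A → B`. -/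
noncomputable def pullback (k : PMap A B) (X : PSpace.{w}) :
    HClass (Susp B) X →* HClass (Susp A) X :=
  MonoidHom.mk' (HClass.precomp (map k) X) (by
    rintro ⟨f⟩ ⟨g⟩
    exact congrArg HClass.mk (mul_comp_map f g k))

theorem pullback_id (f : HClass (Susp A) X) : pullback (PMap.id A) X f = f := by
  obtain ⟨f⟩ := f
  exact congrArg (fun k => HClass.mk (f.comp k)) map_id

theorem pullback_const (f : HClass (Susp B) X) : pullback (PMap.const A B) X f = 1 := by
  obtain ⟨f⟩ := f
  exact congrArg HClass.mk ((congrArg f.comp map_const).trans (PMap.comp_const f))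

theorem pullback_pullback {C : PSpace.{x}} (g : PMap B C) (k : PMap A B)
    (f : HClass (Susp C) X) : pullback k X (pullback g X f) = pullback (g.comp k) X f := by
  obtain ⟨f⟩ := f
  exact congrArg (fun l => HClass.mk (f.comp l)) (map_comp_map g k)

end Susp

/-! ### Cofibrations and cofibres -/

section LocallyCompact

variable {T : Type u} {X : Type v} {Y : Type w} {Z : Type x} [TopologicalSpace T]
  [TopologicalSpace X] [TopologicalSpace Y] [TopologicalSpace Z] [LocallyCompactSpace T] {q : X → Y}

open Topology

theorem isQuotientMap_prodMap_id (hq : IsQuotientMap q) :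
    IsQuotientMap (Prod.map q (id : T → T)) := by
  refine (isQuotientMap_iff _).2 ⟨?_, hq.surjective.prodMap Function.surjective_id⟩
  refine isCoinducing_iff.2 fun s => ⟨fun hs => ?_, fun hs => ?_⟩
  · exact isOpen_iff_continuous_mem.2
      (hq.continuous_lift_prod_left (isOpen_iff_continuous_mem.1 hs))
  · exact hs.preimage (hq.continuous.prodMap continuous_id)

theorem exists_continuousMap_prod_lift (hq : IsQuotientMap q) (F : C(T × X, Z))
    (hF : ∀ t a a', q a = q a' → F (t, a) = F (t, a')) :
    ∃ G : C(T × Y, Z), ∀ t a, G (t, q a) = F (t, a) := by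
  let s := Function.surjInv hq.surjective
  have hG : ∀ t a, F (t, s (q a)) = F (t, a) := fun t a =>
    hF t _ _ (Function.surjInv_eq hq.surjective (q a))
  refine ⟨⟨fun y => F (y.1, s y.2), hq.continuous_lift_prod_right ?_⟩, hG⟩
  simp only [hG]
  exact F.continuous

end LocallyCompact

namespace PMap

variable {A B C S X X' : PSpace.{u}} {i : PMap B A} {q : PMap A C}

/-- The homotopy extension property of `i : B → A` with respect to pointed maps to pointed spaces
and pointed homotopies. The extension `D` is pointed because `i` is. -/
def IsCofibration (i : PMap B A) : Prop :=
  ∀ ⦃X : PSpace.{u}⦄ (f : PMap A X) (N : C(I × B, X)), (∀ b, N (0, b) = f.toMap (i.toMap b)) →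
    (∀ t, N (t, B.pt) = X.pt) →
    ∃ D : C(I × A, X), (∀ a, D (0, a) = f.toMap a) ∧ ∀ t b, D (t, i.toMap b) = N (t, b)

/-- The map `q : A → C` is the strict cofibre of `i : B → A`: up to homeomorphism, it is the
quotient map `A → A / i(B)`. -/
structure IsCofiber (i : PMap B A) (q : PMap A C) : Prop where
  isQuotientMap : Topology.IsQuotientMap q.toMap
  comp_eq_const : q.comp i = const B C
  eq_or_mem_range : ∀ ⦃a a'⦄, q.toMap a = q.toMap a' →
    a = a' ∨ (a ∈ Set.range i.toMap ∧ a' ∈ Set.range i.toMap)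

namespace IsCofiber

theorem factorsThrough (hq : IsCofiber i q) {Y : Type v} {f : A → Y} {y : Y}
    (hf : ∀ b, f (i.toMap b) = y) : Function.FactorsThrough f q.toMap := by
  intro a a' h
  obtain rfl | ⟨⟨b, rfl⟩, ⟨b', rfl⟩⟩ := hq.eq_or_mem_range h
  · rfl
  · rw [hf, hf]

theorem exists_comp_eq (hq : IsCofiber i q) {f : PMap A X} (hf : f.comp i = const B X) :
    ∃ g : PMap C X, g.comp q = f := by
  let g := hq.isQuotientMap.lift f.toMap (hq.factorsThrough (congr_apply hf))
  have hg : g.comp q.toMap = f.toMap := hq.isQuotientMap.lift_comp _ _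
  refine ⟨⟨g, ?_⟩, PMap.ext hg⟩
  rw [← q.map_pt, ← ContinuousMap.comp_apply, hg, f.map_pt]

theorem homotopic_of_comp (hq : IsCofiber i q) {g g' : PMap C X} (F : C(I × A, X))
    (h0 : ∀ a, F (0, a) = g.toMap (q.toMap a)) (h1 : ∀ a, F (1, a) = g'.toMap (q.toMap a))
    (hF : ∀ t b, F (t, i.toMap b) = X.pt) : g.Homotopic g' := by
  obtain ⟨G, hG⟩ := exists_continuousMap_prod_lift hq.isQuotientMap F fun t _ _ h =>
    hq.factorsThrough (f := fun a => F (t, a)) (hF t) h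
  refine homotopic_iff_exists.2 ⟨G, hq.isQuotientMap.surjective.forall.2 fun a => ?_,
    hq.isQuotientMap.surjective.forall.2 fun a => ?_, fun t => ?_⟩
  · rw [hG, h0]
  · rw [hG, h1]
  · rw [← q.map_pt, hG, ← i.map_pt, hF]

end IsCofiber

theorem IsCofibration.exists_lift (hi : IsCofibration i) (hq : IsCofiber i q) {f : PMap A X}
    {m : PMap B S} {j : PMap S X} (hm : m.Homotopic (const B S)) (hfi : f.comp i = j.comp m)
    {h : PMap X X'} (hj : h.comp j = const S X') {f' : PMap C X'} (hf' : f'.comp q = h.comp f) :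
    ∃ g : PMap C X, f.Homotopic (g.comp q) ∧ f'.Homotopic (h.comp g) := by
  obtain ⟨M, hM0, hM1, hM⟩ := homotopic_iff_exists.1 hm
  obtain ⟨D, hD0, hDi⟩ := hi f (j.toMap.comp M)
    (fun b => (congrArg j.toMap (hM0 b)).trans (congr_apply hfi b).symm)
    (fun t => (congrArg j.toMap (hM t)).trans j.map_pt)
  have hDpt : ∀ t, D (t, A.pt) = X.pt := fun t => by
    rw [← i.map_pt, hDi]
    exact (congrArg j.toMap (hM t)).trans j.map_pt
  let d : PMap A X := ⟨D.comp ⟨fun a => (1, a), by fun_prop⟩, hDpt 1⟩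
  have hd : d.comp i = const B X := PMap.ext <| ContinuousMap.ext fun b =>
    (hDi 1 b).trans ((congrArg j.toMap (hM1 b)).trans j.map_pt)
  obtain ⟨g, hg⟩ := hq.exists_comp_eq hd
  have hD1 : ∀ a, D (1, a) = g.toMap (q.toMap a) := fun a => (congr_apply hg a).symm
  refine ⟨g, homotopic_iff_exists.2 ⟨D, hD0, hD1, hDpt⟩, ?_⟩
  refine hq.homotopic_of_comp (h.toMap.comp D) (fun a => ?_) (fun a => ?_) fun t b => ?_
  · exact (congrArg h.toMap (hD0 a)).trans (congr_apply hf' a).symm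
  · exact congrArg h.toMap (hD1 a)
  · exact (congrArg h.toMap (hDi t b)).trans (congr_apply hj _)

end PMap

/-- The loop space `ΩX`. It turns the homotopy extension problem for `ΣB → ΣA` and `X` into the one
for `B → A` and `ΩX`. -/
def Loop (X : PSpace.{u}) : PSpace.{u} where
  carrier := Path X.pt X.pt
  pt := Path.refl X.pt

namespace Loop

variable {X : PSpace.{u}} {T : Type v} [TopologicalSpace T]

/-- The map `T → ΩX` that is adjoint to a map on `T × [0,1]`. -/
def curry (F : C(T × I, X)) (h : ∀ t s, s = 0 ∨ s = 1 → F (t, s) = X.pt) : C(T, Loop X) where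
  toFun t :=
    { toFun := fun s => F (t, s)
      continuous_toFun := by fun_prop
      source' := h t 0 (Or.inl rfl)
      target' := h t 1 (Or.inr rfl) }
  continuous_toFun := Path.continuous_uncurry_iff.1 F.continuous

theorem ext {γ γ' : Loop X} (h : ∀ s, Path.toContinuousMap γ s = Path.toContinuousMap γ' s) :
    γ = γ' :=
  Path.ext (funext h)

theorem continuous_eval (F : C(T, Loop X)) :
    Continuous fun y : T × I => Path.toContinuousMap (F y.1) y.2 :=
  Path.continuous_uncurry_iff.2 F.continuous

end Loop

namespace Susp

variable {A : PSpace.{u}} {X : PSpace.{v}}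

theorem exists_point_eq (y : Susp A) : ∃ a s, point a s = y := by
  obtain ⟨⟨a, s⟩, rfl⟩ := (Collapse.isQuotientMap_mk (suspSet A)).surjective y
  exact ⟨a, s, rfl⟩

theorem exists_continuousMap_prod (F : C(I × (A × I), X))
    (hF : ∀ t a s, (a = A.pt ∨ s = 0 ∨ s = 1) → F (t, (a, s)) = X.pt) :
    ∃ G : C(I × Susp A, X), ∀ t a s, G (t, point a s) = F (t, (a, s)) := by
  obtain ⟨G, hG⟩ := exists_continuousMap_prod_lift (Collapse.isQuotientMap_mk (suspSet A)) F
    fun t y y' h => by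
      obtain rfl | ⟨hy, hy'⟩ := Quotient.exact h
      · rfl
      · rw [hF t _ _ hy, hF t _ _ hy']
  exact ⟨G, fun t a s => hG t (a, s)⟩

end Susp

namespace PMap

variable {A B C : PSpace.{u}} {i : PMap B A} {q : PMap A C}

theorem IsCofibration.susp (hi : IsCofibration i) : IsCofibration (Susp.map i) := by
  intro X f N hN hpt
  have hN' : ∀ t b s, b = B.pt ∨ s = 0 ∨ s = 1 → N (t, Susp.point b s) = X.pt := fun t b s h => by
    rw [Susp.point_eq_pt h, hpt]
  let f' : PMap A (Loop X) :=
    ⟨Loop.curry (f.toMap.comp ⟨fun y => Susp.point y.1 y.2, Susp.continuous_point⟩)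
      fun _ _ h => Susp.apply_pt f h, Loop.ext fun _ =>
        (congrArg f.toMap (Susp.point_eq_pt (Or.inl rfl))).trans f.map_pt⟩
  let N' : C(I × B, Loop X) :=
    Loop.curry (N.comp ⟨fun y : (I × B) × I => (y.1.1, Susp.point y.1.2 y.2),
      (by fun_prop : Continuous fun y : (I × B) × I => y.1.1).prodMk
        (Susp.continuous_point.comp
          (by fun_prop : Continuous fun y : (I × B) × I => (y.1.2, y.2)))⟩)
      fun y s h => hN' y.1 y.2 s (Or.inr h)
  obtain ⟨D, hD0, hDi⟩ := hi f' N' (fun b => Loop.ext fun s => hN (Susp.point b s))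
    fun t => Loop.ext fun s => hN' t B.pt s (Or.inl rfl)
  obtain ⟨G, hG⟩ := Susp.exists_continuousMap_prod (X := X)
    ⟨fun y : I × (A × I) => Path.toContinuousMap (D (y.1, y.2.1)) y.2.2,
      (Loop.continuous_eval D).comp
        (by fun_prop : Continuous fun y : I × (A × I) => ((y.1, y.2.1), y.2.2))⟩ <| by
    rintro t a s (rfl | rfl | rfl)
    · rw [← i.map_pt, ContinuousMap.coe_mk, hDi]
      exact hN' t B.pt s (Or.inl rfl)
    · exact Path.source _
    · exact Path.target _
  refine ⟨G, fun y => ?_, fun t y => ?_⟩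
  · obtain ⟨a, s, rfl⟩ := Susp.exists_point_eq y
    rw [hG, ContinuousMap.coe_mk, hD0]
    rfl
  · obtain ⟨b, s, rfl⟩ := Susp.exists_point_eq y
    refine (hG t (i.toMap b) s).trans ?_
    rw [ContinuousMap.coe_mk, hDi]
    rfl

theorem IsCofiber.susp (hq : IsCofiber i q) : IsCofiber (Susp.map i) (Susp.map q) where
  isQuotientMap := by
    refine .of_comp_isQuotientMap (Collapse.isQuotientMap_mk (suspSet A)) ?_
    exact (Collapse.isQuotientMap_mk (suspSet C)).comp (isQuotientMap_prodMap_id hq.isQuotientMap)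
  comp_eq_const := by rw [Susp.map_comp_map, hq.comp_eq_const, Susp.map_const]
  eq_or_mem_range := by
    have mem_range : ∀ a s, q.toMap a = C.pt ∨ s = 0 ∨ s = 1 →
        Susp.point a s ∈ Set.range (Susp.map i).toMap := by
      rintro a s (h | h)
      · obtain rfl | ⟨⟨b, rfl⟩, -⟩ := hq.eq_or_mem_range (h.trans q.map_pt.symm)
        · exact ⟨(Susp B).pt, (Susp.map i).map_pt.trans (Susp.point_eq_pt (Or.inl rfl)).symm⟩
        · exact ⟨Susp.point b s, rfl⟩
      · exact ⟨(Susp B).pt, (Susp.map i).map_pt.trans (Susp.point_eq_pt (Or.inr h)).symm⟩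
    intro y y' h
    obtain ⟨a, s, rfl⟩ := Susp.exists_point_eq y
    obtain ⟨a', s', rfl⟩ := Susp.exists_point_eq y'
    obtain h | ⟨h, h'⟩ := Quotient.exact h
    · obtain ⟨h, rfl⟩ := Prod.mk.inj h
      obtain rfl | ⟨⟨b, rfl⟩, ⟨b', rfl⟩⟩ := hq.eq_or_mem_range h
      · exact Or.inl rfl
      · exact Or.inr ⟨⟨Susp.point b s, rfl⟩, ⟨Susp.point b' s, rfl⟩⟩
    · exact Or.inr ⟨mem_range a s h, mem_range a' s' h'⟩

end PMap

/-! ### Split extensions of groups -/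

section SplitExact

variable {G H K : Type*} [Group G] [Group H] [Group K] {r : G →* H} {s : H →* G} {j : K →* G}

theorem bijective_mul_of_leftInverse (hs : Function.LeftInverse r s) (hj : Function.Injective j)
    (hrange : j.range = r.ker) : Function.Bijective fun x : K × H => s x.2 * j x.1 := by
  have hrj : ∀ a, r (j a) = 1 := fun a => by
    rw [← MonoidHom.mem_ker, ← hrange]
    exact ⟨a, rfl⟩
  constructor
  · rintro ⟨a, b⟩ ⟨a', b'⟩ h
    obtain rfl : b = b' := by simpa [hrj, hs _] using congrArg r h
    exact congrArg (·, b) (hj (mul_left_cancel h))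
  · intro g
    have hg : (s (r g))⁻¹ * g ∈ j.range := by
      rw [hrange, MonoidHom.mem_ker, map_mul, map_inv, hs, inv_mul_cancel]
    obtain ⟨a, ha⟩ := hg
    exact ⟨(a, r g), mul_eq_of_eq_inv_mul ha⟩

theorem existsUnique_map_eq_conj (hj : Function.Injective j) (hrange : j.range = r.ker) (g : G)
    (a : K) : ∃! a', j a' = g⁻¹ * j a * g := by
  have hmem : g⁻¹ * j a * g ∈ j.range := by
    rw [hrange]
    exact r.normal_ker.conj_mem' _ (hrange ▸ ⟨a, rfl⟩) g
  obtain ⟨a', ha'⟩ := hmem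
  exact ⟨a', ha', fun a'' ha'' => hj (ha''.trans ha'.symm)⟩

end SplitExact

/-! ### Split cofibrations after one suspension -/

/-- A cofibration `i : B → A` with cofibre `q : A → C` and a retraction `p : A → B`. The case of the
theorem is `W^(k-1) ⊔ * → W^k ⊔ *`, with the pinch map and the projection. -/
structure SplitCofibration {A B C : PSpace.{u}} (i : PMap B A) (p : PMap A B) (q : PMap A C) :
    Prop where
  isCofibration : i.IsCofibration
  isCofiber : i.IsCofiber q
  comp_eq_id : p.comp i = PMap.id B

/-- The map `ΣA → ΣC ∨ ΣB` that represents `(a, b) ↦ p^*(b) q^*(a)`: it runs through `Σp` and then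
through `Σq`. -/
noncomputable def suspSplit {A B C : PSpace.{u}} (p : PMap A B) (q : PMap A C) :
    PMap (Susp A) (Wedge (Susp C) (Susp B)) :=
  Susp.mul ((Wedge.inr (Susp C) (Susp B)).comp (Susp.map p))
    ((Wedge.inl (Susp C) (Susp B)).comp (Susp.map q))

theorem precomp_suspSplit {A B C : PSpace.{u}} (p : PMap A B) (q : PMap A C) {X : PSpace.{v}}
    (f : HClass (Wedge (Susp C) (Susp B)) X) :
    HClass.precomp (suspSplit p q) X f =
      Susp.pullback p X (HClass.precomp (Wedge.inr _ _) X f) *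
        Susp.pullback q X (HClass.precomp (Wedge.inl _ _) X f) := by
  obtain ⟨f⟩ := f
  exact congrArg HClass.mk (Susp.comp_mul f _ _)

namespace SplitCofibration

variable {A B C : PSpace.{u}} {i : PMap B A} {p : PMap A B} {q : PMap A C}

/- The obstruction to splitting off `ΣC` is that `[Σ(i ∘ p)]⁻¹ [1]` is trivial on `ΣB` only up to
the homotopy `[Σi]⁻¹ [Σi] = 1`. This homotopy is a loop and its inverse in `ΣB`, so it becomes
constant under `Σq`, and the homotopy extension property carries it over. -/
theorem exists_section (h : SplitCofibration i p q) : ∃ γ : PMap (Susp C) (Susp A),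
    HClass.mk (γ.comp (Susp.map q)) =
      (HClass.mk (Susp.map (i.comp p)))⁻¹ * HClass.mk (PMap.id (Susp A)) ∧
    HClass.mk ((Susp.map q).comp γ) = HClass.mk (PMap.id (Susp C)) := by
  have hpi := PMap.congr_apply h.comp_eq_id
  have hqi := PMap.congr_apply h.isCofiber.comp_eq_const
  have hf : (Susp.mul ((Susp.map (i.comp p)).comp (Susp.rev A)) (PMap.id _)).comp (Susp.map i) =
      (Susp.map i).comp (Susp.mul ((PMap.id (Susp B)).comp (Susp.rev B)) (PMap.id _)) := by
    rw [Susp.mul_comp_map, Susp.comp_mul]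
    refine congrArg (Susp.mul · (Susp.map i)) (Susp.hom_ext fun b t => ?_)
    exact congrArg (fun b' => Susp.point (i.toMap b') _) (hpi b)
  have hf' : (Susp.mul (PMap.const _ _) (PMap.id (Susp C))).comp (Susp.map q) =
      (Susp.map q).comp (Susp.mul ((Susp.map (i.comp p)).comp (Susp.rev A)) (PMap.id _)) := by
    rw [Susp.mul_comp_map, Susp.comp_mul]
    refine congrArg (Susp.mul · (Susp.map q)) (Susp.hom_ext fun a t => ?_)
    exact (Susp.point_eq_pt (Or.inl (hqi (p.toMap a)))).symm
  obtain ⟨γ, hγ, hγ'⟩ := h.isCofibration.susp.exists_lift h.isCofiber.susp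
    (Susp.rev_mul_homotopic _) hf h.isCofiber.susp.comp_eq_const hf'
  refine ⟨γ, (HClass.mk_eq_mk.2 hγ).symm, (HClass.mk_eq_mk.2 hγ').symm.trans ?_⟩
  exact HClass.mk_eq_mk.2 (Susp.one_mul_homotopic _)

variable {X : PSpace.{v}}

theorem leftInverse_pullback (h : SplitCofibration i p q) :
    Function.LeftInverse (Susp.pullback i X) (Susp.pullback p X) := fun f => by
  rw [Susp.pullback_pullback, h.comp_eq_id, Susp.pullback_id]

theorem injective_pullback (h : SplitCofibration i p q) :
    Function.Injective (Susp.pullback q X) := by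
  obtain ⟨γ, -, hγ⟩ := h.exists_section
  refine Function.LeftInverse.injective (g := HClass.precomp γ X) ?_
  rintro ⟨f⟩
  exact congrArg (HClass.postcomp (Susp C) f) hγ

theorem range_pullback (h : SplitCofibration i p q) :
    (Susp.pullback q X).range = (Susp.pullback i X).ker := by
  ext f
  rw [MonoidHom.mem_range, MonoidHom.mem_ker]
  constructor
  · rintro ⟨f, rfl⟩
    rw [Susp.pullback_pullback, h.isCofiber.comp_eq_const, Susp.pullback_const]
  · intro hf
    obtain ⟨γ, hγ, -⟩ := h.exists_section
    obtain ⟨f, rfl⟩ := HClass.exists_mk_eq f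
    refine ⟨HClass.mk (f.comp γ), ?_⟩
    calc Susp.pullback q X (HClass.mk (f.comp γ))
        = Susp.pushforward A f (HClass.mk (γ.comp (Susp.map q))) := rfl
      _ = (Susp.pullback (i.comp p) X (HClass.mk f))⁻¹ * HClass.mk f := by
          rw [hγ, map_mul, map_inv]
          rfl
      _ = HClass.mk f := by
          rw [← Susp.pullback_pullback, hf, map_one, inv_one, one_mul]

theorem bijective_precomp_suspSplit (h : SplitCofibration i p q) :
    Function.Bijective (HClass.precomp (suspSplit p q) X) := by
  have key := (bijective_mul_of_leftInverse (h.leftInverse_pullback (X := X)) h.injective_pullback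
    h.range_pullback).comp (Wedge.bijective_precomp_inl_inr (Susp C) (Susp B) X)
  rwa [funext (precomp_suspSplit p q)]

theorem isHomotopyEquiv_suspSplit (h : SplitCofibration i p q) :
    (suspSplit p q).IsHomotopyEquiv :=
  HClass.isHomotopyEquiv_of_bijective_precomp fun _ => h.bijective_precomp_suspSplit

end SplitCofibration

/-! ### The co-action and the co-multiplication -/

section Comultiplication

variable {A B C : PSpace.{u}} {p : PMap A B} {q : PMap A C}

/-- The map `α : ΣC → ΣB ∨ ΣC` represents the action `a · b = b⁻¹ a b` of `[ΣB, X]` on `[ΣC, X]`,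
both seen in `[ΣA, X]`. -/
def IsSuspCoaction (p : PMap A B) (q : PMap A C) (α : PMap (Susp C) (Wedge (Susp B) (Susp C))) :
    Prop :=
  HClass.mk (α.comp (Susp.map q)) =
    (Susp.pullback p _ (HClass.mk (Wedge.inl _ _)))⁻¹ *
      Susp.pullback q _ (HClass.mk (Wedge.inr _ _)) * Susp.pullback p _ (HClass.mk (Wedge.inl _ _))

/-- The co-multiplication on `Q = ΣC ∨ ΣB` given by a co-action `α`. Write `a₁, b₁` and `a₂, b₂` for
the inclusions of `ΣC, ΣB` into the two copies of `Q`; then it is `(b₂, a₁) ∘ α` followed by `a₂` on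
`ΣC`, and `b₁` followed by `b₂` on `ΣB`. -/
noncomputable def suspComul (α : PMap (Susp C) (Wedge (Susp B) (Susp C))) :
    PMap (Wedge (Susp C) (Susp B))
      (Wedge (Wedge (Susp C) (Susp B)) (Wedge (Susp C) (Susp B))) :=
  let Q := Wedge (Susp C) (Susp B)
  Wedge.desc
    (Susp.mul
      ((Wedge.desc ((Wedge.inr Q Q).comp (Wedge.inr _ _))
        ((Wedge.inl Q Q).comp (Wedge.inl _ _))).comp α)
      ((Wedge.inr Q Q).comp (Wedge.inl _ _)))
    (Susp.mul ((Wedge.inl Q Q).comp (Wedge.inr _ _)) ((Wedge.inr Q Q).comp (Wedge.inr _ _)))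

theorem IsSuspCoaction.mk_desc_comp {α : PMap (Susp C) (Wedge (Susp B) (Susp C))}
    (hα : IsSuspCoaction p q α) {X : PSpace.{v}} (b : PMap (Susp B) X) (a : PMap (Susp C) X) :
    Susp.pullback q X (HClass.mk ((Wedge.desc b a).comp α)) =
      (Susp.pullback p X (HClass.mk b))⁻¹ * Susp.pullback q X (HClass.mk a) *
        Susp.pullback p X (HClass.mk b) := by
  refine (congrArg (Susp.pushforward A (Wedge.desc b a)) hα).trans ?_
  rw [map_mul, map_mul, map_inv]
  rfl

theorem IsSuspCoaction.mk_suspComul_comp {α : PMap (Susp C) (Wedge (Susp B) (Susp C))}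
    (hα : IsSuspCoaction p q α) :
    HClass.mk ((suspComul α).comp (suspSplit p q)) =
      HClass.mk ((Wedge.inl _ _).comp (suspSplit p q)) *
        HClass.mk ((Wedge.inr _ _).comp (suspSplit p q)) := by
  let Q := Wedge (Susp C) (Susp B)
  let a₁ := (Wedge.inl Q Q).comp (Wedge.inl (Susp C) (Susp B))
  let a₂ := (Wedge.inr Q Q).comp (Wedge.inl (Susp C) (Susp B))
  let b₁ := (Wedge.inl Q Q).comp (Wedge.inr (Susp C) (Susp B))
  let b₂ := (Wedge.inr Q Q).comp (Wedge.inr (Susp C) (Susp B))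
  let p' := Susp.pullback p (Wedge Q Q)
  let q' := Susp.pullback q (Wedge Q Q)
  calc HClass.mk ((suspComul α).comp (suspSplit p q))
      = p' (HClass.mk b₁ * HClass.mk b₂) *
          q' (HClass.mk ((Wedge.desc b₂ a₁).comp α) * HClass.mk a₂) :=
        precomp_suspSplit p q (HClass.mk (suspComul α))
    _ = p' (HClass.mk b₁) * p' (HClass.mk b₂) *
          ((p' (HClass.mk b₂))⁻¹ * q' (HClass.mk a₁) * p' (HClass.mk b₂) * q' (HClass.mk a₂)) := by
        rw [map_mul, map_mul, hα.mk_desc_comp]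
    _ = p' (HClass.mk b₁) * q' (HClass.mk a₁) * (p' (HClass.mk b₂) * q' (HClass.mk a₂)) := by
        group
    _ = _ := (congrArg₂ (· * ·) (precomp_suspSplit p q (HClass.mk (Wedge.inl Q Q)))
        (precomp_suspSplit p q (HClass.mk (Wedge.inr Q Q)))).symm

theorem SplitCofibration.exists_isSuspCoaction {i : PMap B A} (h : SplitCofibration i p q) :
    ∃ α, IsSuspCoaction p q α ∧ ∀ β, IsSuspCoaction p q β → β.Homotopic α := by
  obtain ⟨α, hα, hα'⟩ := existsUnique_map_eq_conj (h.injective_pullback (X := Wedge _ _))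
    h.range_pullback (Susp.pullback p _ (HClass.mk (Wedge.inl _ _))) (HClass.mk (Wedge.inr _ _))
  obtain ⟨α, rfl⟩ := HClass.exists_mk_eq α
  exact ⟨α, hα, fun β hβ => HClass.mk_eq_mk.1 (hα' (HClass.mk β) hβ)⟩

end Comultiplication

section InducesGroupStructure

variable {A Q : PSpace.{u}} {e : PMap (Susp A) Q} {μ : PMap Q (Wedge Q Q)}

theorem inducesGroupStructure_iff : InducesGroupStructure e μ ↔
    HClass.mk (μ.comp e) = HClass.mk ((Wedge.inl Q Q).comp e) *
      HClass.mk ((Wedge.inr Q Q).comp e) := by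
  constructor
  · intro h
    have h' := h _ (Wedge.inl Q Q) (Wedge.inr Q Q)
    rwa [Wedge.desc_inl_inr] at h'
  · intro h _ f g
    exact (congrArg (Susp.pushforward A (Wedge.desc f g)) h).trans (map_mul _ _ _)

theorem InducesGroupStructure.isComultiplication (h : InducesGroupStructure e μ)
    (he : Function.Injective (HClass.precomp e Q)) : IsComultiplication μ :=
  ⟨HClass.mk_eq_mk.1 (he ((h _ _ _).trans (mul_one _))),
    HClass.mk_eq_mk.1 (he ((h _ _ _).trans (one_mul _)))⟩

theorem InducesGroupStructure.iff_homotopic (h : InducesGroupStructure e μ)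
    (he : Function.Injective (HClass.precomp e (Wedge Q Q))) {ν : PMap Q (Wedge Q Q)} :
    InducesGroupStructure e ν ↔ ν.Homotopic μ := by
  rw [inducesGroupStructure_iff, ← inducesGroupStructure_iff.1 h, ← HClass.mk_eq_mk]
  exact he.eq_iff (a := HClass.mk ν) (b := HClass.mk μ)

end InducesGroupStructure

/-! ### Well-pointed spaces and their powers -/

section HomotopyExtension

open Topology

variable {A : Type u} {B : Type v} [TopologicalSpace A] [TopologicalSpace B]

/- The space `W` is arbitrary, so `{w₀}` need not be closed and the two branches of an extended
homotopy agree on the frontier only up to specialization. -/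
theorem continuous_if_of_specializes {s : Set A} {f g : A → B} [DecidablePred (· ∈ s)]
    (hf : Continuous f) (hg : Continuous g) (hs : IsClosed s)
    (hfg : ∀ a ∈ frontier s, g a ⤳ f a) : Continuous fun a => if a ∈ s then f a else g a := by
  refine continuous_iff_continuousAt.2 fun a => ?_
  by_cases ha : a ∈ s
  · rw [ContinuousAt, if_pos ha]
    by_cases ha' : s ∈ 𝓝 a
    · refine hf.continuousAt.congr' ?_
      filter_upwards [ha'] with b hb
      rw [if_pos hb]
    · have hafr : a ∈ frontier s := ⟨subset_closure ha, mt mem_interior_iff_mem_nhds.1 ha'⟩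
      exact hf.continuousAt.if' (hg.continuousAt.mono_right (hfg a hafr))
  · refine hg.continuousAt.congr ?_
    filter_upwards [hs.isOpen_compl.mem_nhds ha] with b hb
    rw [if_neg hb]

theorem WellPointed.exists_retraction {W : Type u} [TopologicalSpace W] {w₀ : W}
    (hW : WellPointed W w₀) :
    ∃ (r : C(I × W, W)) (τ : C(I × W, I)), (∀ y, τ y = 0 ∨ r y = w₀) ∧
      (∀ a, r (0, a) = a ∧ τ (0, a) = 0) ∧ ∀ t, r (t, w₀) = w₀ ∧ τ (t, w₀) = t := by
  let W' : PSpace.{u} := ⟨W, w₀⟩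
  let I' : PSpace.{0} := ⟨I, (0 : I)⟩
  obtain ⟨H, H0, H1⟩ := hW (Wedge W' I') (Wedge.inl W' I').toMap (Wedge.inr W' I').toMap
    ((Wedge.inr W' I').map_pt.trans (Wedge.inl W' I').map_pt.symm)
  let r : PMap (Wedge W' I') W' := Wedge.desc (PMap.id W') (PMap.const I' W')
  let τ : PMap (Wedge W' I') I' := Wedge.desc (PMap.const W' I') (PMap.id I')
  have hrτ : ∀ z, τ.toMap z = (0 : I) ∨ r.toMap z = w₀ :=
    (Collapse.isQuotientMap_mk _).surjective.forall.2 <| by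
      rintro (a | t)
      · exact Or.inl rfl
      · exact Or.inr rfl
  refine ⟨r.toMap.comp (H.comp .prodSwap), τ.toMap.comp (H.comp .prodSwap), fun y => hrτ _,
    fun a => ⟨?_, ?_⟩, fun t => ⟨?_, ?_⟩⟩
  · exact congrArg r.toMap (H0 a)
  · exact congrArg τ.toMap (H0 a)
  · exact congrArg r.toMap (H1 t)
  · exact congrArg τ.toMap (H1 t)

/-- The unpointed homotopy extension property of `i : B → A`, for all maps to spaces in the universe
of `A`. -/
def HasHomotopyExtension (i : C(B, A)) : Prop :=
  ∀ ⦃Y : Type u⦄ [TopologicalSpace Y] (f : C(A, Y)) (N : C(I × B, Y)),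
    (∀ b, N (0, b) = f (i b)) →
      ∃ D : C(I × A, Y), (∀ a, D (0, a) = f a) ∧ ∀ t b, D (t, i b) = N (t, b)

theorem WellPointed.hasHomotopyExtension_prodMk {W : Type u} [TopologicalSpace W] {w₀ : W}
    (hW : WellPointed W w₀) (B : Type u) [TopologicalSpace B] :
    HasHomotopyExtension (⟨fun b => (b, w₀), by fun_prop⟩ : C(B, B × W)) := by
  intro Y _ f N hN
  obtain ⟨r, τ, hrτ, hr0, hr1⟩ := hW.exists_retraction
  let s : Set (I × (B × W)) := {y | τ (y.1, y.2.2) = 0}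
  have hs : IsClosed s := isClosed_eq (by fun_prop) continuous_const
  have hw₀ : ∀ y ∈ frontier s, w₀ ⤳ r (y.1, y.2.2) := fun y hy => by
    have hmaps : Set.MapsTo (fun y : I × (B × W) => r (y.1, y.2.2)) sᶜ {w₀} :=
      fun y hy => (hrτ _).resolve_left hy
    rw [← frontier_compl] at hy
    exact specializes_iff_mem_closure.2 (hmaps.closure (by fun_prop) (frontier_subset_closure hy))
  classical
  let D : I × (B × W) → Y := fun y =>
    if y ∈ s then f (y.2.1, r (y.1, y.2.2)) else N (τ (y.1, y.2.2), y.2.1)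
  have hD : Continuous D := by
    refine continuous_if_of_specializes (by fun_prop) (by fun_prop) hs fun y hy => ?_
    rw [show τ (y.1, y.2.2) = 0 from hs.frontier_subset hy, hN]
    exact (hw₀ y hy).map (by fun_prop : Continuous fun w => f (y.2.1, w))
  refine ⟨⟨D, hD⟩, fun ⟨b, w⟩ => ?_, fun t b => ?_⟩
  · have h0 : ((0, (b, w)) : I × (B × W)) ∈ s := (hr0 w).2
    exact (if_pos h0).trans (by rw [(hr0 w).1])
  · change (if τ (t, w₀) = 0 then f (b, r (t, w₀)) else N (τ (t, w₀), b)) = N (t, b)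
    rw [(hr1 t).1, (hr1 t).2]
    split_ifs with ht
    · rw [ht, hN]
      rfl
    · rfl

end HomotopyExtension

/-- The map `Y ⊔ * → Z ⊔ *` induced by a map `Y → Z`. -/
def Plus.map {Y : Type u} {Z : Type v} [TopologicalSpace Y] [TopologicalSpace Z] (f : C(Y, Z)) :
    PMap (Plus Y) (Plus Z) :=
  ⟨⟨Sum.map f _root_.id, f.continuous.sumMap continuous_id⟩, rfl⟩

theorem HasHomotopyExtension.isCofibration_plusMap {A B : Type u} [TopologicalSpace A]
    [TopologicalSpace B] {i : C(B, A)} (hi : HasHomotopyExtension i) :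
    (Plus.map i).IsCofibration := by
  intro X f N hN hpt
  obtain ⟨D, hD0, hDi⟩ := hi (f.toMap.comp ⟨Sum.inl, continuous_inl⟩)
    (N.comp ⟨fun y : I × B => (y.1, Sum.inl y.2), by fun_prop⟩) fun b => hN (Sum.inl b)
  let D' : C(I × (A ⊕ Unit), X) :=
    ⟨Sum.elim D (fun _ => X.pt) ∘ Homeomorph.prodSumDistrib,
      (D.continuous.sumElim continuous_const).comp (Homeomorph.continuous _)⟩
  refine ⟨D', ?_, ?_⟩
  · rintro (a | _)
    · exact hD0 a
    · exact f.map_pt.symm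
  · rintro t (b | _)
    · exact hDi t b
    · exact (hpt t).symm

section Power

variable (W : Type u) [TopologicalSpace W] (w₀ : W) (m : ℕ)

/-- The inclusion `W^m ⊂ W^(m+1)` as the set of points with last coordinate `w₀`. -/
def snocBase : C(Fin m → W, Fin (m + 1) → W) :=
  ⟨fun x => Fin.snoc (α := fun _ => W) x w₀,
    Continuous.finSnoc (A := fun _ => W) continuous_id continuous_const⟩

variable {W w₀}

theorem WellPointed.hasHomotopyExtension_snocBase (hW : WellPointed W w₀) :
    HasHomotopyExtension (snocBase W w₀ m) := by
  intro Y _ f N hN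
  obtain ⟨D, hD0, hDi⟩ := hW.hasHomotopyExtension_prodMk (Fin m → W)
    (f.comp ⟨fun y => Fin.snoc (α := fun _ => W) y.1 y.2,
      Continuous.finSnoc (A := fun _ => W) continuous_fst continuous_snd⟩) N hN
  refine ⟨D.comp ⟨fun y => (y.1, (Fin.init y.2, y.2 (Fin.last m))), ?_⟩, fun x => ?_, fun t x => ?_⟩
  · exact continuous_fst.prodMk (continuous_snd.finInit.prodMk (by fun_prop))
  · exact (hD0 _).trans (congrArg f (Fin.snoc_init_self x))
  · refine Eq.trans ?_ (hDi t x)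
    exact congrArg (fun y => D (t, y)) (Prod.ext
      (Fin.init_snoc (α := fun _ => W) w₀ x) (Fin.snoc_last (α := fun _ => W) w₀ x))

variable (w₀)

theorem lastAtBase_eq_range_snocBase :
    lastAtBase W w₀ (m + 1) = Set.range (snocBase W w₀ m) := by
  ext x
  constructor
  · intro hx
    refine ⟨Fin.init x, ?_⟩
    change Fin.snoc (Fin.init x) w₀ = x
    rw [← hx (Fin.last m) rfl, Fin.snoc_init_self]
  · rintro ⟨x, rfl⟩ j hj
    obtain rfl : j = Fin.last m := Fin.ext (Nat.succ_injective hj)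
    exact Fin.snoc_last (α := fun _ => W) w₀ x

theorem isCofiber_pinch : (Plus.map (snocBase W w₀ m)).IsCofiber (pinch W w₀ (m + 1)) where
  isQuotientMap := .of_comp continuous_inl (pinch W w₀ (m + 1)).toMap.continuous
    (Collapse.isQuotientMap_mk (lastAtBase W w₀ (m + 1)))
  comp_eq_const := by
    ext (x | _)
    · refine Collapse.mk_eq ?_ fun _ _ => rfl
      exact lastAtBase_eq_range_snocBase w₀ m ▸ ⟨x, rfl⟩
    · rfl
  eq_or_mem_range := by
    have mem_range : ∀ x ∈ lastAtBase W w₀ (m + 1),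
        (Sum.inl x : (Fin (m + 1) → W) ⊕ Unit) ∈ Set.range (Plus.map (snocBase W w₀ m)).toMap := by
      rw [lastAtBase_eq_range_snocBase]
      rintro _ ⟨x, rfl⟩
      exact ⟨Sum.inl x, rfl⟩
    have pt_mem_range : (Plus (Fin (m + 1) → W)).pt ∈
        Set.range (Plus.map (snocBase W w₀ m)).toMap := ⟨Sum.inr (), rfl⟩
    rintro (x | _) (y | _) h <;> obtain h | ⟨hx, hy⟩ := Quotient.exact h
    · exact Or.inl (congrArg Sum.inl h)
    · exact Or.inr ⟨mem_range x hx, mem_range y hy⟩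
    · exact Or.inr ⟨mem_range x (h ▸ fun _ _ => rfl), pt_mem_range⟩
    · exact Or.inr ⟨mem_range x hx, pt_mem_range⟩
    · exact Or.inr ⟨pt_mem_range, mem_range y (h ▸ fun _ _ => rfl)⟩
    · exact Or.inr ⟨pt_mem_range, mem_range y hy⟩
    · exact Or.inl rfl
    · exact Or.inl rfl

variable {w₀}

theorem WellPointed.splitCofibration (hW : WellPointed W w₀) :
    SplitCofibration (Plus.map (snocBase W w₀ m)) (proj W (m + 1)) (pinch W w₀ (m + 1)) where
  isCofibration := (hW.hasHomotopyExtension_snocBase m).isCofibration_plusMap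
  isCofiber := isCofiber_pinch w₀ m
  comp_eq_id := by
    ext (x | _)
    · exact congrArg (Sum.inl (β := Unit)) (Fin.init_snoc (α := fun _ => W) w₀ x)
    · rfl

end Power

theorem foxComul_eq_suspComul (W : Type u) [TopologicalSpace W] (w₀ : W) (n : ℕ)
    (α : PMap (Susp (Pinched W w₀ (n - 1)))
      (Wedge (Fox W (n - 1)) (Susp (Pinched W w₀ (n - 1))))) :
    foxComul W w₀ n α = suspComul α := by
  have h := Wedge.comp_desc (foxIncl W w₀ n) ((Wedge.inl _ _).comp α)
    ((Wedge.inr _ _).comp (PMap.id _))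
  exact congrArg (fun m => Wedge.desc (m.comp (Susp.comul _)) (foxComulOne W w₀ n)) h

end FoxSpace

open FoxSpace in
theorem theorem2_general {A B C : PSpace} {i : PMap B A} {p : PMap A B} {q : PMap A C}
    (h : SplitCofibration i p q) :
    (suspSplit p q).IsHomotopyEquiv ∧
    (∃ α, IsSuspCoaction p q α ∧ ∀ β, IsSuspCoaction p q β → β.Homotopic α) ∧
    ∀ α, IsSuspCoaction p q α →
      IsComultiplication (suspComul α) ∧
      ((suspComul α).comp (suspSplit p q)).Homotopic
        ((Wedge.map (suspSplit p q) (suspSplit p q)).comp (Susp.comul A)) ∧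
      ∀ ν, InducesGroupStructure (suspSplit p q) ν ↔ ν.Homotopic (suspComul α) := by
  refine ⟨h.isHomotopyEquiv_suspSplit, h.exists_isSuspCoaction, fun α hα => ?_⟩
  have key := inducesGroupStructure_iff.2 hα.mk_suspComul_comp
  exact ⟨key.isComultiplication h.bijective_precomp_suspSplit.injective,
    HClass.mk_eq_mk.1 hα.mk_suspComul_comp,
    fun _ => key.iff_homotopic h.bijective_precomp_suspSplit.injective⟩

theorem theorem2 (W : Type*) [TopologicalSpace W] (w₀ : W)
    (hW : FoxSpace.WellPointed W w₀) (n : ℕ) (hn : 1 < n) :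
    (FoxSpace.foxSplit W w₀ n).IsHomotopyEquiv ∧
    (∃ α, FoxSpace.IsCoaction W w₀ n α ∧
      ∀ β, FoxSpace.IsCoaction W w₀ n β → β.Homotopic α) ∧
    ∀ α, FoxSpace.IsCoaction W w₀ n α →
      FoxSpace.IsComultiplication (FoxSpace.foxComul W w₀ n α) ∧
      ((FoxSpace.foxComul W w₀ n α).comp (FoxSpace.foxSplit W w₀ n)).Homotopic
        ((FoxSpace.Wedge.map (FoxSpace.foxSplit W w₀ n) (FoxSpace.foxSplit W w₀ n)).comp
          (FoxSpace.Susp.comul (FoxSpace.Plus (Fin (n - 1) → W)))) ∧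
      ∀ ν : FoxSpace.PMap (FoxSpace.FoxWedge W w₀ n)
          (FoxSpace.Wedge (FoxSpace.FoxWedge W w₀ n) (FoxSpace.FoxWedge W w₀ n)),
        FoxSpace.InducesGroupStructure (A := FoxSpace.Plus (Fin (n - 1) → W))
            (FoxSpace.foxSplit W w₀ n) ν ↔
          ν.Homotopic (FoxSpace.foxComul W w₀ n α) := by
  obtain ⟨m, rfl⟩ : ∃ m, n = m + 2 := ⟨n - 2, by omega⟩
  simp only [FoxSpace.foxComul_eq_suspComul]
  exact theorem2_general (hW.splitCofibration m)
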